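/- For $n\ge 3$ let $L_n(a,b,-,d)$ be the language over the alphabet $\{a,b,d\}$ accepted by the deterministic finite automaton with state set $\{1,\dots,n\}$, initial state $1$, unique final state $n$, in which $a$ induces the cycle $(1,2,\dots,n-1)$, $b$ induces the cycle $(2,3,\dots,n-1)$ (the identity if $n=3$), and $d$ sends $n-1$ to $n$; every letter fixes all states not mentioned. (Equivalently, it is the language obtained by deleting the letter $c$, that is, by removing all words containing $c$ and restricting the alphabet to $\{a,b,d\}$, from the language $L_n(a,b,c,d)$ of the automaton that has the additional letter $c$, which sends $n-1$ to $1$ and fixes all other states.) The complexity of a language $L$ over an alphabet $\Sigma$ is the number of distinct left quotients $w^{-1}L=\{x\in\Sigma^*\mid wx\in L\}$, $w\in\Sigma^*$; for a regular language this is the number of states of a minimal complete deterministic automaton over $\Sigma$ accepting $L$. Suppose $m,n\ge 3$ and $m\ne n$. Then, as languages over $\{a,b,d\}$: 1. the complexity of $L_m(a,b,-,d)\cap L_n(a,b,-,d)$ is $mn$; 2. the complexity of the symmetric difference $L_m(a,b,-,d)\oplus L_n(a,b,-,d)$ is $mn$; 3. the complexity of $L_m(a,b,-,d)\setminus L_n(a,b,-,d)$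 is $mn-(m-1)$; 4. the complexity of $L_m(a,b,-,d)\cup L_n(a,b,-,d)$ is $mn-(m+n-2)$. -/

import Mathlib

namespace RightIdeal

/-- The (quotient/state) complexity `κ(L)` of a language `L`: the number of distinct left quotients
`w⁻¹L = {x | wx ∈ L}`, where `w` ranges over all words over the alphabet of `L`
(`⊤` if there are infinitely many). -/
noncomputable def complexity {α : Type*} (L : Language α) : ℕ∞ :=
  (Set.range L.leftQuotient).encard

/-- The alphabet `π(Σ)` of a permutational dialect: the letters that are values of the partial
permutation `π` of `Σ`. -/
abbrev DialectAlphabet {α : Type*} (π : α ≃. α) : Type _ :=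
  {y : α // ∃ x : α, π x = some y}

/-- The permutational dialect `s_π(L)`, a language over the alphabet `π(Σ)`: it consists of the words
`π(x₁)⋯π(x_k)` for those words `x₁⋯x_k ∈ L` for which all of `π(x₁), …, π(x_k)` are defined. -/
def dialect {α : Type*} (π : α ≃. α) (L : Language α) : Language (DialectAlphabet π) :=
  {w | ∃ u ∈ L, u.map π = w.map (fun y => some y.1)}

/-- The ordered alphabet `Σ = {a, b, c, d}`. -/
inductive Letter : Type
  | a | b | c | d
  deriving DecidableEq

/-- The map of `ℕ` that acts as the cycle `(i, i+1, …, j)` on `{i, …, j}` and fixes all other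
numbers (it is the identity if `i = j`). -/
def cycle (i j q : ℕ) : ℕ :=
  if i ≤ q ∧ q < j then q + 1 else if q = j then i else q

/-- The map of `ℕ` that sends `i` to `j` and fixes all other numbers, written `(i → j)`. -/
def moveTo (i j q : ℕ) : ℕ :=
  if q = i then j else q

/-- The transformations induced by the letters:
`a : (1, …, n-1)`, `b : (2, …, n-1)`, `c : (n-1 → 1)`, `d : (n-1 → n)`. -/
def transformation (n : ℕ) : Letter → ℕ → ℕ
  | .a => cycle 1 (n - 1)
  | .b => cycle 2 (n - 1)
  | .c => moveTo (n - 1) 1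
  | .d => moveTo (n - 1) n

/-- The state set `Q_n = {1, …, n}`. -/
abbrev State (n : ℕ) : Type := {q : ℕ // 1 ≤ q ∧ q ≤ n}

theorem transformation_mem {n : ℕ} (hn : 3 ≤ n) (x : Letter) (q : State n) :
    1 ≤ transformation n x q.1 ∧ transformation n x q.1 ≤ n := by
  obtain ⟨q, h1, h2⟩ := q
  cases x <;> simp only [transformation, cycle, moveTo] <;> split_ifs <;> omega

/-- The DFA `D_n(a,b,c,d) = (Q_n, Σ, δ_n, 1, {n})`, for `n ≥ 3`. -/
def witnessDFA (n : ℕ) (hn : 3 ≤ n) : DFA Letter (State n) where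
  step q x := ⟨transformation n x q.1, transformation_mem hn x q⟩
  start := ⟨1, by omega⟩
  accept := {q | q.1 = n}

/-- The language `L_n(a,b,c,d)` accepted by `D_n(a,b,c,d)`. -/
def witnessLanguage (n : ℕ) (hn : 3 ≤ n) : Language Letter :=
  (witnessDFA n hn).accepts

/-- The partial permutation `a ↦ a`, `b ↦ b`, `d ↦ d`, undefined at `c`; in list form `(a, b, -, d)`. -/
def eraseC : Letter ≃. Letter where
  toFun
    | .c => none
    | x => some x
  invFun
    | .c => none
    | x => some x
  inv x y := by cases x <;> cases y <;> simp

/-- The language `L_n(a,b,-,d)` over the alphabet `{a, b, d}`. -/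
def witnessABD (n : ℕ) (hn : 3 ≤ n) : Language (DialectAlphabet eraseC) :=
  dialect eraseC (witnessLanguage n hn)

end RightIdeal

/-!
The quotients of a Boolean combination of `L(M)` and `L(N)` are the same Boolean combinations of the
languages accepted from the states `p` of `M` and `q` of `N`, for the pairs `(p, q)` that can be
reached. Here all pairs are reachable, and for every pair of states there is a word that is
rejected from these two states, unless they are final, and accepted from all other states. This
determines which pairs yield the same quotient. To construct the word for `(p, q)`, move the pair to
`(1, 1)`; since letters merge distinct states only into the final state, no other state is then in
state `1`, so the word `(db)^k` sends all of them to the final state while fixing `1`. Reachability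
rests on the letters `a` and `b` being permutations, so that everything they reach also leads back,
and on `m ≠ n`: if `m < n`, then `a^(m-1)` takes `(1, 1)` off the diagonal, to `(1, m)`.
-/

namespace RightIdeal

section BooleanCombination

variable {α σ τ : Type*}

/-- The combination of two languages by a binary Boolean operation, given by its truth function. -/
def combine (φ : Prop → Prop → Prop) (L K : Language α) : Language α :=
  {w | φ (w ∈ L) (w ∈ K)}

theorem mem_combine {φ : Prop → Prop → Prop} {L K : Language α} {w : List α} :
    w ∈ combine φ L K ↔ φ (w ∈ L) (w ∈ K) :=
  Iff.rfl

theorem complexity_combine_accepts (φ : Prop → Prop → Prop) {M : DFA α σ} {N : DFA α τ}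
    (hMN : ∀ p q, ∃ w, M.eval w = p ∧ N.eval w = q) :
    complexity (combine φ M.accepts N.accepts) =
      (Set.range fun s : σ × τ => combine φ (M.acceptsFrom s.1) (N.acceptsFrom s.2)).encard := by
  have hquot (w : List α) : (combine φ M.accepts N.accepts).leftQuotient w =
      combine φ (M.acceptsFrom (M.eval w)) (N.acceptsFrom (N.eval w)) := by
    rw [← Language.leftQuotient_accepts_apply, ← Language.leftQuotient_accepts_apply]
    rfl
  have hsurj : Function.Surjective fun w => (M.eval w, N.eval w) := fun s =>
    let ⟨w, hp, hq⟩ := hMN s.1 s.2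
    ⟨w, Prod.ext hp hq⟩
  rw [complexity, ← hsurj.range_comp]
  exact congrArg (fun f => (Set.range f).encard) (funext hquot)

theorem encard_range_of_injOn_of_const_compl {X Y : Type*} {f : X → Y} {s : Set X} {c : Y}
    (hinj : s.InjOn f) (hne : ∀ x ∈ s, f x ≠ c) (hc : ∀ x ∉ s, f x = c) (hs : sᶜ.Nonempty) :
    (Set.range f).encard = s.encard + 1 := by
  have hnotMem : c ∉ f '' s := fun ⟨x, hx, hxc⟩ => hne x hx hxc
  have hcompl : f '' sᶜ = {c} := by
    rw [Set.image_congr (s := sᶜ) hc, hs.image_const]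
  rw [← Set.image_univ, ← Set.union_compl_self s, Set.image_union, hcompl, Set.union_singleton,
    Set.encard_insert_of_notMem hnotMem, hinj.encard_image]

/-- All pairs of states of `M` and `N` are simultaneously reachable, everything is accepted from the
states `f` and `g`, and for each pair `(p, q)` some word is rejected exactly from the states among
`p` and `q` that differ from `f` and `g`. The case `p = f` or `q = g` is included, so that a state
can also be isolated in one automaton alone. -/
structure JointlyIsolable (M : DFA α σ) (N : DFA α τ) (f : σ) (g : τ) : Prop where
  mem_acceptsFrom_left : ∀ w, w ∈ M.acceptsFrom f
  mem_acceptsFrom_right : ∀ w, w ∈ N.acceptsFrom g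
  exists_eval : ∀ p q, ∃ w, M.eval w = p ∧ N.eval w = q
  exists_isolating : ∀ p q, ∃ w,
    (∀ p', w ∈ M.acceptsFrom p' ↔ (p' = p → p = f)) ∧
    ∀ q', w ∈ N.acceptsFrom q' ↔ (q' = q → q = g)

namespace JointlyIsolable

variable {M : DFA α σ} {N : DFA α τ} {f : σ} {g : τ} {φ : Prop → Prop → Prop}

theorem iff_of_combine_eq (h : JointlyIsolable M N f g) {s t : σ × τ}
    (hst : combine φ (M.acceptsFrom s.1) (N.acceptsFrom s.2) =
      combine φ (M.acceptsFrom t.1) (N.acceptsFrom t.2)) (p : σ) (q : τ) :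
    φ (s.1 = p → p = f) (s.2 = q → q = g) ↔ φ (t.1 = p → p = f) (t.2 = q → q = g) := by
  obtain ⟨w, hp, hq⟩ := h.exists_isolating p q
  rw [← hp, ← hq, ← hp, ← hq]
  exact iff_of_eq (congrArg (w ∈ ·) hst)

theorem fst_eq_of_combine_eq (h : JointlyIsolable M N f g) (hφ : ¬(φ False True ↔ φ True True))
    {s t : σ × τ} (hst : combine φ (M.acceptsFrom s.1) (N.acceptsFrom s.2) =
      combine φ (M.acceptsFrom t.1) (N.acceptsFrom t.2)) : s.1 = t.1 := by
  by_contra hne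
  wlog hs : s.1 ≠ f generalizing s t
  · exact this hst.symm (Ne.symm hne) fun ht => hne ((not_not.1 hs).trans ht.symm)
  exact hφ (by simpa [hs, Ne.symm hne] using h.iff_of_combine_eq hst s.1 g)

theorem snd_eq_of_combine_eq (h : JointlyIsolable M N f g) (hφ : ¬(φ True False ↔ φ True True))
    {s t : σ × τ} (hst : combine φ (M.acceptsFrom s.1) (N.acceptsFrom s.2) =
      combine φ (M.acceptsFrom t.1) (N.acceptsFrom t.2)) : s.2 = t.2 := by
  by_contra hne
  wlog hs : s.2 ≠ g generalizing s t
  · exact this hst.symm (Ne.symm hne) fun ht => hne ((not_not.1 hs).trans ht.symm)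
  exact hφ (by simpa [hs, Ne.symm hne] using h.iff_of_combine_eq hst f s.2)

theorem complexity_combine (h : JointlyIsolable M N f g) (hφl : ¬(φ False True ↔ φ True True))
    (hφr : ¬(φ True False ↔ φ True True)) :
    complexity (combine φ M.accepts N.accepts) = ENat.card σ * ENat.card τ := by
  have hinj : Function.Injective fun s : σ × τ =>
      combine φ (M.acceptsFrom s.1) (N.acceptsFrom s.2) := fun s t hst =>
    Prod.ext (h.fst_eq_of_combine_eq hφl hst) (h.snd_eq_of_combine_eq hφr hst)
  rw [complexity_combine_accepts φ h.exists_eval, ← Set.image_univ, hinj.encard_image,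
    Set.encard_univ, ENat.card_prod]

theorem complexity_inf (h : JointlyIsolable M N f g) :
    complexity (M.accepts ⊓ N.accepts) = ENat.card σ * ENat.card τ :=
  h.complexity_combine (φ := fun a b => a ∧ b) (by simp) (by simp)

theorem complexity_symmDiff (h : JointlyIsolable M N f g) :
    complexity (symmDiff M.accepts N.accepts) = ENat.card σ * ENat.card τ :=
  h.complexity_combine (φ := fun a b => a ∧ ¬b ∨ b ∧ ¬a) (by simp) (by simp)

theorem complexity_sdiff (h : JointlyIsolable M N f g) :
    complexity (M.accepts \ N.accepts) = ENat.card σ * ({g}ᶜ : Set τ).encard + 1 := by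
  let φ : Prop → Prop → Prop := fun a b => a ∧ ¬b
  rw [← Set.encard_univ, ← Set.encard_prod]
  refine (complexity_combine_accepts φ h.exists_eval).trans
    (encard_range_of_injOn_of_const_compl (c := combine φ (M.acceptsFrom f) (N.acceptsFrom g))
      ?_ ?_ ?_ ⟨(f, g), by simp⟩)
  · rintro ⟨p, q⟩ ⟨-, hq : q ≠ g⟩ ⟨p', q'⟩ - hst
    obtain rfl : q = q' := h.snd_eq_of_combine_eq (by simp [φ]) hst
    by_contra hne
    have hp : p ≠ p' := fun hp => hne (by rw [hp])
    have hl := h.iff_of_combine_eq hst p q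
    have hr := h.iff_of_combine_eq hst p' q
    grind
  · rintro ⟨p, q⟩ ⟨-, hq : q ≠ g⟩ hst
    exact hq (h.snd_eq_of_combine_eq (t := (f, g)) (by simp [φ]) hst)
  · rintro ⟨p, q⟩ hs
    obtain rfl : q = g := by simpa using hs
    ext w
    simp [mem_combine, φ, h.mem_acceptsFrom_right]

theorem complexity_sup (h : JointlyIsolable M N f g) :
    complexity (M.accepts ⊔ N.accepts) = ({f}ᶜ : Set σ).encard * ({g}ᶜ : Set τ).encard + 1 := by
  let φ : Prop → Prop → Prop := fun a b => a ∨ b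
  rw [← Set.encard_prod]
  refine (complexity_combine_accepts φ h.exists_eval).trans
    (encard_range_of_injOn_of_const_compl (c := combine φ (M.acceptsFrom f) (N.acceptsFrom g))
      ?_ ?_ ?_ ⟨(f, g), by simp⟩)
  · rintro ⟨p, q⟩ ⟨hp : p ≠ f, hq : q ≠ g⟩ ⟨p', q'⟩ - hst
    have := h.iff_of_combine_eq hst p q
    grind
  · rintro ⟨p, q⟩ ⟨hp : p ≠ f, hq : q ≠ g⟩ hst
    have := h.iff_of_combine_eq (t := (f, g)) hst p q
    grind
  · rintro ⟨p, q⟩ hs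
    have hpq : p = f ∨ q = g := by grind
    ext w
    rcases hpq with rfl | rfl <;>
      simp [mem_combine, φ, h.mem_acceptsFrom_left, h.mem_acceptsFrom_right]

end JointlyIsolable

end BooleanCombination

section Reachability

variable {α σ τ : Type*} {M : DFA α σ} {N : DFA α τ}

/-- Some word takes `M` from `p.1` to `q.1` and `N` from `p.2` to `q.2`. -/
def JointlyReaches (M : DFA α σ) (N : DFA α τ) (p q : σ × τ) : Prop :=
  ∃ w, M.evalFrom p.1 w = q.1 ∧ N.evalFrom p.2 w = q.2

instance : Std.Refl (JointlyReaches M N) :=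
  ⟨fun _ => ⟨[], rfl, rfl⟩⟩

instance : IsTrans (σ × τ) (JointlyReaches M N) where
  trans := by
    rintro p q r ⟨v, hv₁, hv₂⟩ ⟨w, hw₁, hw₂⟩
    exact ⟨v ++ w, by rw [DFA.evalFrom_of_append, hv₁, hw₁],
      by rw [DFA.evalFrom_of_append, hv₂, hw₂]⟩

theorem JointlyReaches.swap {p q : σ × τ} (h : JointlyReaches M N p q) :
    JointlyReaches N M p.swap q.swap :=
  let ⟨w, h₁, h₂⟩ := h
  ⟨w, h₂, h₁⟩

theorem jointlyReaches_of_step_eq {p q : σ × τ} {x : α} (h₁ : M.step p.1 x = q.1)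
    (h₂ : N.step p.2 x = q.2) : JointlyReaches M N p q :=
  ⟨[x], h₁, h₂⟩

/-- Mutual reachability of pairs of states. -/
abbrev Communicates (M : DFA α σ) (N : DFA α τ) : σ × τ → σ × τ → Prop :=
  AntisymmRel (JointlyReaches M N)

theorem Communicates.swap {p q : σ × τ} (h : Communicates M N p q) :
    Communicates N M p.swap q.swap :=
  ⟨h.1.swap, h.2.swap⟩

theorem communicates_of_step_eq [Finite σ] [Finite τ] {x : α} (hM : (M.step · x).Injective)
    (hN : (N.step · x).Injective) {p q : σ × τ} (h₁ : M.step p.1 x = q.1)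
    (h₂ : N.step p.2 x = q.2) : Communicates M N p q := by
  let F : σ × τ → σ × τ := Prod.map (M.step · x) (N.step · x)
  have hiter (k : ℕ) : JointlyReaches M N q (F^[k] q) := by
    induction k with
    | zero => exact refl_of _ q
    | succ k ih =>
      rw [Function.iterate_succ_apply']
      exact trans_of _ ih (jointlyReaches_of_step_eq rfl rfl)
  obtain ⟨k, hk, hp⟩ := (hM.prodMap hN).mem_periodicPts p
  have hq : F p = q := Prod.ext h₁ h₂
  have hback : F^[k - 1] q = p := by
    rwa [← hq, ← Function.iterate_succ_apply, Nat.succ_eq_add_one, Nat.sub_add_cancel hk]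
  exact ⟨jointlyReaches_of_step_eq h₁ h₂, hback ▸ hiter (k - 1)⟩

theorem evalFrom_eq_self_of_absorbing {f : σ} (hf : ∀ x, M.step f x = f) (w : List α) :
    M.evalFrom f w = f :=
  List.foldl_fixed' hf w

theorem eq_or_evalFrom_eq_of_absorbing {f : σ} (hf : ∀ x, M.step f x = f)
    (hmerge : ∀ x p q, M.step p x = M.step q x → p = q ∨ M.step p x = f) (w : List α) {p q : σ}
    (h : M.evalFrom p w = M.evalFrom q w) : p = q ∨ M.evalFrom p w = f := by
  induction w generalizing p q with
  | nil => exact .inl h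
  | cons x w ih =>
    obtain hstep | hfinal := ih h
    · refine (hmerge x p q hstep).imp_right fun hx => ?_
      rw [DFA.evalFrom_cons, hx, evalFrom_eq_self_of_absorbing hf]
    · exact .inr hfinal

end Reachability

section Dialect

variable {α : Type*} {π : α ≃. α}

theorem mem_dialect_iff_of_le_refl (hπ : π ≤ PEquiv.refl α) {L : Language α}
    {w : List (DialectAlphabet π)} : w ∈ dialect π L ↔ w.map Subtype.val ∈ L := by
  have heq {x y : α} (h : π x = some y) : x = y := Option.some.inj (hπ x y h)
  have hval (y : DialectAlphabet π) : π y.1 = some y.1 := by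
    obtain ⟨y, x, hx⟩ := y
    exact heq hx ▸ hx
  constructor
  · rintro ⟨u, hu, huw⟩
    have hlen : u.length = w.length := by simpa using congrArg List.length huw
    have hget (i : ℕ) (hi : i < u.length) (_ : i < (w.map Subtype.val).length) :
        u[i] = (w.map Subtype.val)[i] := by
      have hi' := List.getElem_of_eq huw (i := i) (by simpa using hi)
      simp only [List.getElem_map] at hi' ⊢
      exact heq hi'
    rwa [← List.ext_getElem (by simpa using hlen) hget]
  · intro hw
    refine ⟨w.map Subtype.val, hw, ?_⟩
    rw [List.map_map]
    exact List.map_congr_left fun y _ => hval y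

theorem eraseC_le_refl : eraseC ≤ PEquiv.refl Letter := by
  rintro (_ | _ | _ | _) y h
  · exact h
  · exact h
  · cases h
  · exact h

theorem DialectAlphabet.ne_c (x : DialectAlphabet eraseC) : x.1 ≠ .c := by
  obtain ⟨x, y, h⟩ := x
  rintro rfl
  obtain rfl : Letter.c = y := Option.some.inj (eraseC_le_refl y _ h).symm
  cases h

end Dialect

section Transformations

theorem cycle_injective {i j : ℕ} (hij : i ≤ j) : (cycle i j).Injective := by
  intro p q h
  grind [cycle]

variable {n : ℕ}

theorem transformation_self (hn : 3 ≤ n) (x : Letter) : transformation n x n = n := by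
  cases x <;> simp only [transformation] <;> grind [cycle, moveTo]

theorem eq_or_transformation_eq (hn : 3 ≤ n) {x : Letter} (hx : x ≠ .c) {p q : ℕ}
    (h : transformation n x p = transformation n x q) :
    p = q ∨ transformation n x p = n := by
  cases x with
  | a => exact .inl (cycle_injective (by omega) h)
  | b => exact .inl (cycle_injective (by omega) h)
  | c => exact absurd rfl hx
  | d =>
    simp only [transformation] at h ⊢
    grind [moveTo]

end Transformations

/-- The letter `a` of the alphabet `{a, b, d}`. -/
def letterA : DialectAlphabet eraseC := ⟨.a, .a, rfl⟩

/-- The letter `b` of the alphabet `{a, b, d}`. -/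
def letterB : DialectAlphabet eraseC := ⟨.b, .b, rfl⟩

/-- The letter `d` of the alphabet `{a, b, d}`. -/
def letterD : DialectAlphabet eraseC := ⟨.d, .d, rfl⟩

/-- The restriction of `witnessDFA n hn` to the alphabet `{a, b, d}`. -/
def abdDFA (n : ℕ) (hn : 3 ≤ n) : DFA (DialectAlphabet eraseC) (State n) :=
  (witnessDFA n hn).comap Subtype.val

instance (n : ℕ) : Finite (State n) :=
  (Set.finite_Icc 1 n).to_subtype

theorem enat_card_state (n : ℕ) : ENat.card (State n) = n := by
  change (Set.Icc 1 n).encard = n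
  rw [← Finset.coe_Icc, Set.encard_coe_eq_coe_finsetCard, Nat.card_Icc, Nat.add_sub_cancel]

/-- The final state `n`. -/
def final (n : ℕ) (hn : 3 ≤ n) : State n := ⟨n, by omega, le_rfl⟩

section SingleAutomaton

variable {n : ℕ} (hn : 3 ≤ n)

theorem val_lt_of_ne_final {q : State n} (hq : q ≠ final n hn) : q.1 < n :=
  lt_of_le_of_ne q.2.2 fun h => hq (Subtype.ext h)

theorem encard_compl_final : ({final n hn}ᶜ : Set (State n)).encard = ((n - 1 : ℕ) : ℕ∞) := by
  rw [Set.compl_eq_univ_sdiff, Set.encard_sdiff_singleton_of_mem (Set.mem_univ _), Set.encard_univ,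
    enat_card_state]
  rfl

theorem witnessABD_eq_accepts : witnessABD n hn = (abdDFA n hn).accepts := by
  ext w
  rw [witnessABD, mem_dialect_iff_of_le_refl eraseC_le_refl, abdDFA, DFA.accepts_comap]
  rfl

theorem mem_abdDFA_accept {q : State n} : q ∈ (abdDFA n hn).accept ↔ q = final n hn :=
  (Subtype.ext_iff (a2 := final n hn)).symm

theorem abdDFA_start_ne_final : (abdDFA n hn).start ≠ final n hn := by
  intro h
  have : 1 = n := congrArg Subtype.val h
  omega

theorem abdDFA_step_final (x : DialectAlphabet eraseC) :
    (abdDFA n hn).step (final n hn) x = final n hn :=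
  Subtype.ext (transformation_self hn x.1)

theorem mem_acceptsFrom_final (w : List (DialectAlphabet eraseC)) :
    w ∈ (abdDFA n hn).acceptsFrom (final n hn) :=
  (mem_abdDFA_accept hn).2 (evalFrom_eq_self_of_absorbing (abdDFA_step_final hn) w)

theorem eq_or_abdDFA_step_eq_final (x : DialectAlphabet eraseC) (p q : State n)
    (h : (abdDFA n hn).step p x = (abdDFA n hn).step q x) :
    p = q ∨ (abdDFA n hn).step p x = final n hn :=
  (eq_or_transformation_eq hn x.ne_c (congrArg Subtype.val h)).imp Subtype.ext Subtype.ext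

theorem abdDFA_step_letterA_injective : ((abdDFA n hn).step · letterA).Injective := fun _ _ h =>
  Subtype.ext (cycle_injective (by omega) (congrArg Subtype.val h))

theorem abdDFA_step_letterB_injective : ((abdDFA n hn).step · letterB).Injective := fun _ _ h =>
  Subtype.ext (cycle_injective (by omega) (congrArg Subtype.val h))

/-- The word `(db)^k`, which fixes state `1` and, for large `k`, sends all other states to the final
state. -/
def collapse (k : ℕ) : List (DialectAlphabet eraseC) :=
  (List.replicate k [letterD, letterB]).flatten

theorem collapse_succ (k : ℕ) : collapse (k + 1) = [letterD, letterB] ++ collapse k := rfl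

theorem evalFrom_start_collapse (k : ℕ) :
    (abdDFA n hn).evalFrom (abdDFA n hn).start (collapse k) = (abdDFA n hn).start := by
  have hstep : (abdDFA n hn).evalFrom (abdDFA n hn).start [letterD, letterB] =
      (abdDFA n hn).start := Subtype.ext (show cycle 2 (n - 1) (moveTo (n - 1) n 1) = 1 by
    grind [cycle, moveTo])
  induction k with
  | zero => rfl
  | succ k ih => rw [collapse_succ, DFA.evalFrom_of_append, hstep, ih]

theorem evalFrom_collapse_val {q : State n} (hq : 2 ≤ q.1) (k : ℕ) :
    ((abdDFA n hn).evalFrom q (collapse k)).1 = min n (q.1 + k) := by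
  induction k generalizing q with
  | zero => exact (min_eq_right q.2.2).symm
  | succ k ih =>
    have hstep : ((abdDFA n hn).evalFrom q [letterD, letterB]).1 = min n (q.1 + 1) := by
      change cycle 2 (n - 1) (moveTo (n - 1) n q.1) = _
      grind [cycle, moveTo]
    rw [collapse_succ, DFA.evalFrom_of_append, ih (by omega), hstep]
    omega

theorem evalFrom_collapse_of_ne_start {q : State n} (hq : q ≠ (abdDFA n hn).start) {k : ℕ}
    (hk : n ≤ k) : (abdDFA n hn).evalFrom q (collapse k) = final n hn := by
  have hq' : q.1 ≠ 1 := fun h => hq (Subtype.ext h)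
  exact Subtype.ext ((evalFrom_collapse_val hn (by omega) k).trans (min_eq_left (by omega)))

theorem mem_acceptsFrom_append_collapse_append {p : State n}
    {v : List (DialectAlphabet eraseC)}
    (hv : (abdDFA n hn).evalFrom p v = (abdDFA n hn).start) {k : ℕ} (hk : n ≤ k)
    (u : List (DialectAlphabet eraseC)) (q : State n) :
    v ++ collapse k ++ u ∈ (abdDFA n hn).acceptsFrom q ↔
      (q = p → (abdDFA n hn).eval u = final n hn) := by
  rw [DFA.mem_acceptsFrom, mem_abdDFA_accept, DFA.evalFrom_of_append, DFA.evalFrom_of_append]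
  obtain rfl | hqp := eq_or_ne q p
  · simp [hv, evalFrom_start_collapse, DFA.eval]
  · have hne : (abdDFA n hn).evalFrom q v ≠ (abdDFA n hn).start := fun h =>
      (eq_or_evalFrom_eq_of_absorbing (abdDFA_step_final hn) (eq_or_abdDFA_step_eq_final hn) v
        (h.trans hv.symm)).elim hqp (h ▸ abdDFA_start_ne_final hn)
    simp [hqp, evalFrom_collapse_of_ne_start hn hne hk,
      evalFrom_eq_self_of_absorbing (abdDFA_step_final hn)]

theorem exists_isolating_endpoints (p : State n) :
    ∃ p₀ ≠ final n hn, ∃ p₁, ∀ p', (p' = p₀ → p₁ = final n hn) ↔ (p' = p → p = final n hn) := by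
  by_cases hp : p = final n hn
  · exact ⟨_, abdDFA_start_ne_final hn, final n hn, by simp [hp]⟩
  · exact ⟨p, hp, (abdDFA n hn).start, by simp [hp, abdDFA_start_ne_final hn]⟩

end SingleAutomaton

section TwoAutomata

variable {m n : ℕ} (hm : 3 ≤ m) (hn : 3 ≤ n)

theorem communicates_letterA {p q : State m × State n} (h₁ : cycle 1 (m - 1) p.1 = q.1)
    (h₂ : cycle 1 (n - 1) p.2 = q.2) : Communicates (abdDFA m hm) (abdDFA n hn) p q :=
  communicates_of_step_eq (abdDFA_step_letterA_injective hm) (abdDFA_step_letterA_injective hn)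
    (Subtype.ext h₁) (Subtype.ext h₂)

theorem communicates_letterB {p q : State m × State n} (h₁ : cycle 2 (m - 1) p.1 = q.1)
    (h₂ : cycle 2 (n - 1) p.2 = q.2) : Communicates (abdDFA m hm) (abdDFA n hn) p q :=
  communicates_of_step_eq (abdDFA_step_letterB_injective hm) (abdDFA_step_letterB_injective hn)
    (Subtype.ext h₁) (Subtype.ext h₂)

theorem communicates_one_two_one {j : ℕ} (hj : 2 ≤ j) (hjn : j < n) :
    Communicates (abdDFA m hm) (abdDFA n hn) (⟨1, by omega⟩, ⟨2, by omega⟩)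
      (⟨1, by omega⟩, ⟨j, by omega⟩) := by
  induction j, hj using Nat.le_induction with
  | base => exact .rfl
  | succ j hj ih =>
    exact (ih (by omega)).trans
      (communicates_letterB hm hn (by grind [cycle]) (by grind [cycle]))

theorem communicates_add_add {i j : ℕ} (hi : 1 ≤ i) (hj : 1 ≤ j) (k : ℕ) (hik : i + k < m)
    (hjk : j + k < n) :
    Communicates (abdDFA m hm) (abdDFA n hn) (⟨i, by omega⟩, ⟨j, by omega⟩)
      (⟨i + k, by omega⟩, ⟨j + k, by omega⟩) := by
  induction k with
  | zero => exact .rfl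
  | succ k ih =>
    exact (ih (by omega) (by omega)).trans
      (communicates_letterA hm hn (by grind [cycle]) (by grind [cycle]))

theorem communicates_one_one_one_two (hmn : m < n) :
    Communicates (abdDFA m hm) (abdDFA n hn) (⟨1, by omega⟩, ⟨1, by omega⟩)
      (⟨1, by omega⟩, ⟨2, by omega⟩) := by
  have hdiag := communicates_add_add hm hn le_rfl le_rfl (m - 2) (by omega) (by omega)
  have hwrap : Communicates (abdDFA m hm) (abdDFA n hn)
      (⟨1 + (m - 2), by omega⟩, ⟨1 + (m - 2), by omega⟩) (⟨1, by omega⟩, ⟨m, by omega⟩) :=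
    communicates_letterA hm hn (by grind [cycle]) (by grind [cycle])
  exact (hdiag.trans hwrap).trans (communicates_one_two_one hm hn (by omega) hmn).symm

theorem communicates_one_two_two_one :
    Communicates (abdDFA m hm) (abdDFA n hn) (⟨1, by omega⟩, ⟨2, by omega⟩)
      (⟨2, by omega⟩, ⟨1, by omega⟩) :=
  (communicates_one_two_one hm hn (j := n - 1) (by omega) (by omega)).trans
    (communicates_letterA hm hn (by grind [cycle]) (by grind [cycle]))

theorem communicates_one_one_row (hmn : m < n) {j : ℕ} (hj : 1 ≤ j) (hjn : j < n) :
    Communicates (abdDFA m hm) (abdDFA n hn) (⟨1, by omega⟩, ⟨1, by omega⟩)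
      (⟨1, by omega⟩, ⟨j, by omega⟩) := by
  obtain rfl | hj := hj.eq_or_lt
  · exact .rfl
  · exact (communicates_one_one_one_two hm hn hmn).trans (communicates_one_two_one hm hn hj hjn)

theorem communicates_one_one_column (hmn : m < n) {i : ℕ} (hi : 1 ≤ i) (him : i < m) :
    Communicates (abdDFA m hm) (abdDFA n hn) (⟨1, by omega⟩, ⟨1, by omega⟩)
      (⟨i, by omega⟩, ⟨1, by omega⟩) := by
  obtain rfl | hi := hi.eq_or_lt
  · exact .rfl
  · exact ((communicates_one_one_one_two hm hn hmn).trans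
      (communicates_one_two_two_one hm hn)).trans (communicates_one_two_one hn hm hi him).swap

theorem communicates_one_one_of_lt (hmn : m < n) {i j : ℕ} (hi : 1 ≤ i) (him : i < m)
    (hj : 1 ≤ j) (hjn : j < n) :
    Communicates (abdDFA m hm) (abdDFA n hn) (⟨1, by omega⟩, ⟨1, by omega⟩)
      (⟨i, by omega⟩, ⟨j, by omega⟩) := by
  rcases le_total i j with hij | hji
  · obtain ⟨k, rfl⟩ := Nat.exists_eq_add_of_le hi
    obtain ⟨l, rfl⟩ := Nat.exists_eq_add_of_le' (show k ≤ j by omega)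
    exact (communicates_one_one_row hm hn hmn (by omega) (by omega)).trans
      (communicates_add_add hm hn le_rfl (by omega) k him hjn)
  · obtain ⟨k, rfl⟩ := Nat.exists_eq_add_of_le hj
    obtain ⟨l, rfl⟩ := Nat.exists_eq_add_of_le' (show k ≤ i by omega)
    exact (communicates_one_one_column hm hn hmn (by omega) (by omega)).trans
      (communicates_add_add hm hn (by omega) le_rfl k him hjn)

theorem communicates_start (hmn : m ≠ n) {p : State m} {q : State n} (hp : p ≠ final m hm)
    (hq : q ≠ final n hn) :
    Communicates (abdDFA m hm) (abdDFA n hn) ((abdDFA m hm).start, (abdDFA n hn).start) (p, q) := by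
  have hpm := val_lt_of_ne_final hm hp
  have hqn := val_lt_of_ne_final hn hq
  rcases hmn.lt_or_gt with h | h
  · exact communicates_one_one_of_lt hm hn h p.2.1 hpm q.2.1 hqn
  · exact (communicates_one_one_of_lt hn hm h q.2.1 hqn p.2.1 hpm).swap

theorem jointlyReaches_final_left (hmn : m ≠ n) {q : State n} (hq : q ≠ final n hn) :
    JointlyReaches (abdDFA m hm) (abdDFA n hn) ((abdDFA m hm).start, (abdDFA n hn).start)
      (final m hm, q) := by
  let p : State m := ⟨m - 1, by omega⟩
  have hp : p ≠ final m hm := fun h => by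
    have : m - 1 = m := congrArg Subtype.val h
    omega
  have hstep : JointlyReaches (abdDFA m hm) (abdDFA n hn) (p, (abdDFA n hn).start)
      (final m hm, (abdDFA n hn).start) :=
    jointlyReaches_of_step_eq (x := letterD)
      (Subtype.ext (show moveTo (m - 1) m (m - 1) = m by grind [moveTo]))
      (Subtype.ext (show moveTo (n - 1) n 1 = 1 by grind [moveTo]))
  obtain ⟨w, -, hw⟩ := (communicates_start hm hn hmn (abdDFA_start_ne_final hm) hq).1
  have hmove : JointlyReaches (abdDFA m hm) (abdDFA n hn) (final m hm, (abdDFA n hn).start)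
      (final m hm, q) := ⟨w, evalFrom_eq_self_of_absorbing (abdDFA_step_final hm) w, hw⟩
  exact trans_of _ (communicates_start hm hn hmn hp (abdDFA_start_ne_final hn)).1
    (trans_of _ hstep hmove)

theorem jointlyReaches_final_final (hmn : m ≠ n) :
    JointlyReaches (abdDFA m hm) (abdDFA n hn) ((abdDFA m hm).start, (abdDFA n hn).start)
      (final m hm, final n hn) := by
  obtain ⟨w, hw, -⟩ := jointlyReaches_final_left hn hm hmn.symm (abdDFA_start_ne_final hm)
  exact trans_of _ (jointlyReaches_final_left hm hn hmn (abdDFA_start_ne_final hn))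
    ⟨w, evalFrom_eq_self_of_absorbing (abdDFA_step_final hm) w, hw⟩

theorem jointlyReaches_start (hmn : m ≠ n) (p : State m) (q : State n) :
    JointlyReaches (abdDFA m hm) (abdDFA n hn) ((abdDFA m hm).start, (abdDFA n hn).start)
      (p, q) := by
  by_cases hp : p = final m hm <;> by_cases hq : q = final n hn
  · rw [hp, hq]
    exact jointlyReaches_final_final hm hn hmn
  · rw [hp]
    exact jointlyReaches_final_left hm hn hmn hq
  · rw [hq]
    exact (jointlyReaches_final_left hn hm hmn.symm hp).swap
  · exact (communicates_start hm hn hmn hp hq).1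

theorem jointlyIsolable_abdDFA (hmn : m ≠ n) :
    JointlyIsolable (abdDFA m hm) (abdDFA n hn) (final m hm) (final n hn) where
  mem_acceptsFrom_left := mem_acceptsFrom_final hm
  mem_acceptsFrom_right := mem_acceptsFrom_final hn
  exists_eval := jointlyReaches_start hm hn hmn
  exists_isolating p q := by
    obtain ⟨p₀, hp₀, p₁, hp₁⟩ := exists_isolating_endpoints hm p
    obtain ⟨q₀, hq₀, q₁, hq₁⟩ := exists_isolating_endpoints hn q
    obtain ⟨v, hvm, hvn⟩ := (communicates_start hm hn hmn hp₀ hq₀).2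
    obtain ⟨u, rfl, rfl⟩ := jointlyReaches_start hm hn hmn p₁ q₁
    refine ⟨v ++ collapse (max m n) ++ u, fun p' => ?_, fun q' => ?_⟩
    · exact (mem_acceptsFrom_append_collapse_append hm hvm (le_max_left m n) u p').trans (hp₁ p')
    · exact (mem_acceptsFrom_append_collapse_append hn hvn (le_max_right m n) u q').trans (hq₁ q')

end TwoAutomata

end RightIdeal

theorem mainTheorem8 (m n : ℕ) (hm : 3 ≤ m) (hn : 3 ≤ n) (hmn : m ≠ n) :
    RightIdeal.complexity (RightIdeal.witnessABD m hm ⊓ RightIdeal.witnessABD n hn)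
        = ((m * n : ℕ) : ℕ∞) ∧
    RightIdeal.complexity (symmDiff (RightIdeal.witnessABD m hm) (RightIdeal.witnessABD n hn))
        = ((m * n : ℕ) : ℕ∞) ∧
    RightIdeal.complexity (RightIdeal.witnessABD m hm \ RightIdeal.witnessABD n hn)
        = ((m * n - (m - 1) : ℕ) : ℕ∞) ∧
    RightIdeal.complexity (RightIdeal.witnessABD m hm ⊔ RightIdeal.witnessABD n hn)
        = ((m * n - (m + n - 2) : ℕ) : ℕ∞) := by
  have h := RightIdeal.jointlyIsolable_abdDFA hm hn hmn
  have hsdiff : m * (n - 1) + 1 = m * n - (m - 1) := by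
    have := Nat.le_mul_of_pos_right m (show 0 < n by omega)
    rw [Nat.mul_sub_one]
    omega
  have hsup : (m - 1) * (n - 1) + 1 = m * n - (m + n - 2) := by
    obtain ⟨k, rfl⟩ := Nat.exists_eq_add_of_le' (show 1 ≤ m by omega)
    have := Nat.le_mul_of_pos_right k (show 0 < n by omega)
    rw [Nat.add_sub_cancel, Nat.mul_sub_one, Nat.succ_mul]
    omega
  simp only [RightIdeal.witnessABD_eq_accepts]
  refine ⟨?_, ?_, ?_, ?_⟩
  · rw [h.complexity_inf, RightIdeal.enat_card_state, RightIdeal.enat_card_state, Nat.cast_mul]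
  · rw [h.complexity_symmDiff, RightIdeal.enat_card_state, RightIdeal.enat_card_state, Nat.cast_mul]
  · rw [h.complexity_sdiff, RightIdeal.enat_card_state, RightIdeal.encard_compl_final, ← hsdiff]
    norm_cast
  · rw [h.complexity_sup, RightIdeal.encard_compl_final, RightIdeal.encard_compl_final, ← hsup]
    norm_cast
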